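/- Let $\mathcal H$ be a complex Hilbert space of finite dimension $n$, and let $\{p_i,\rho_i\}_{i=1}^m$ be a linearly independent (LI) ensemble on $\mathcal H$: $p_i>0$, $\sum_i p_i=1$, each $\rho_i$ is a density operator, and, with $r_i=\operatorname{rank}\rho_i$, the supports of $\rho_1,\dots,\rho_m$ are linearly independent subspaces and $\sum_{i=1}^m r_i=n$. Let $\{\Pi_i\}_{i=1}^m$ be an optimal POVM, i.e. one maximizing $\sum_i p_i\operatorname{Tr}(\rho_i\Pi_i)$ over all POVMs with $m$ elements. Let $p_i\rho_i=\sum_{j=1}^{r_i}|\psi_{ij}\rangle\langle\psi_{ij}|$ be any resolution of the $p_i\rho_i$ into unnormalized pure states. Let $G$ be the $n\times n$ Gram matrix with entries $G^{(l\,i)}_{k\,j}=\langle\psi_{lk}|\psi_{ij}\rangle$, where all $n\times n$ matrices are divided into blocks of sizes $r_l\times r_i$ ($1\le l,i\le m$), let $G^{1/2}$ be its positive square root, and put $|u_{ij}\rangle=\sum_{l,k}(G^{-1})^{(l\,i)}_{k\,j}|\psi_{lk}\rangle$. Consider a family of orthonormal vectors $|w_{ij}\rangle$ ($1\le i\le m$,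 $1\le j\le r_i$) and a unitary $n\times n$ matrix $W$ such that $$\Pi_i=\sum_{j=1}^{r_i}|w_{ij}\rangle\langle w_{ij}|,\qquad |w_{ij}\rangle=\sum_{l=1}^m\sum_{k=1}^{r_l}\bigl(G^{1/2}W\bigr)^{(l\,i)}_{k\,j}\,|u_{lk}\rangle ,$$ and such that every diagonal block $X^{(ii)}$ (of size $r_i\times r_i$) of $G^{1/2}W$ is positive semidefinite. Such $|w_{ij}\rangle$ and $W$ exist, and for every such choice $X^{(ii)}$ has rank $r_i$ for all $1\le i\le m$. Consequently the block diagonal matrix $D=\operatorname{Diag}(X^{(11)},\dots,X^{(mm)})$ is positive definite and $DG^{1/2}W$ is nonsingular. -/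

import Mathlib

open scoped ComplexOrder MatrixOrder

namespace MED

section Ensembles

variable {H : Type*} [NormedAddCommGroup H] [InnerProductSpace ℂ H] [FiniteDimensional ℂ H]
  {m : ℕ}

/-- `{p i, ρ i}` is a linearly independent (LI) ensemble of `m` states on `H`, where the state
`ρ i` has rank `r i`: the `p i` are strictly positive probabilities, the `ρ i` are density
operators, their supports are linearly independent subspaces, and the ranks sum up to `dim H`
(so that the supports span `H`). The support of a positive operator is its range. -/
structure IsLIEnsemble (r : Fin m → ℕ) (p : Fin m → ℝ) (ρ : Fin m → (H →ₗ[ℂ] H)) : Prop where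
  prob_pos : ∀ i, 0 < p i
  prob_sum : ∑ i, p i = 1
  state_pos : ∀ i, (ρ i).IsPositive
  state_trace : ∀ i, LinearMap.trace ℂ H (ρ i) = 1
  rank_eq : ∀ i, Module.finrank ℂ (LinearMap.range (ρ i)) = r i
  supp_indep : iSupIndep fun i => LinearMap.range (ρ i)
  rank_sum : ∑ i, r i = Module.finrank ℂ H

/-- An `m`-element POVM on `H`. -/
structure IsPOVM (E : Fin m → (H →ₗ[ℂ] H)) : Prop where
  pos : ∀ i, (E i).IsPositive
  sum_eq_one : ∑ i, E i = 1

/-- The average success probability `∑ i, p i * Tr (ρ i * E i)`, as a real number. -/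
noncomputable def successProb (p : Fin m → ℝ) (ρ E : Fin m → (H →ₗ[ℂ] H)) : ℝ :=
  ∑ i, p i * (LinearMap.trace ℂ H (ρ i * E i)).re

/-- `E` is an optimal POVM for minimum error discrimination of the ensemble `{p i, ρ i}`:
it maximizes the success probability among all `m`-element POVMs. -/
def IsOptimalPOVM (p : Fin m → ℝ) (ρ E : Fin m → (H →ₗ[ℂ] H)) : Prop :=
  IsPOVM E ∧ ∀ F : Fin m → (H →ₗ[ℂ] H), IsPOVM F → successProb p ρ F ≤ successProb p ρ E

/-- The operator `|v⟩⟨v|`. -/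
noncomputable def ketbra (v : H) : H →ₗ[ℂ] H :=
  (InnerProductSpace.rankOne ℂ v v).toLinearMap

end Ensembles

section Vectors

variable {H : Type*} [NormedAddCommGroup H] [InnerProductSpace ℂ H] {m : ℕ} {r : Fin m → ℕ}

/-- The two-tier index `(i, j)` with `i` a block and `j` an index inside the `i`-th block,
which has size `r i`. -/
abbrev BlockIndex (r : Fin m → ℕ) : Type := Σ i : Fin m, Fin (r i)

/-- Matrices divided into blocks of sizes `r i × r j`. -/
abbrev BlockMatrix (r : Fin m → ℕ) : Type := Matrix (BlockIndex r) (BlockIndex r) ℂ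

/-- `ψ` resolves each unnormalized state into pure ones: `p i • ρ i = ∑ j, |ψ i j⟩⟨ψ i j|`,
with exactly `r i` vectors. -/
def IsPureDecomposition (p : Fin m → ℝ) (ρ : Fin m → (H →ₗ[ℂ] H)) (ψ : BlockIndex r → H) :
    Prop :=
  ∀ i, (p i : ℂ) • ρ i = ∑ j : Fin (r i), ketbra (ψ ⟨i, j⟩)

/-- `w` is an orthonormal family that gives a spectral decomposition
`E i = ∑ j, |w i j⟩⟨w i j|` of every element of `E`. -/
def IsSpectralDecomposition (E : Fin m → (H →ₗ[ℂ] H)) (w : BlockIndex r → H) : Prop :=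
  Orthonormal ℂ w ∧ ∀ i, E i = ∑ j : Fin (r i), ketbra (w ⟨i, j⟩)

/-- The Gram matrix `G`, with entries `⟪ψ a, ψ b⟫`. -/
noncomputable def G (ψ : BlockIndex r → H) : BlockMatrix r := Matrix.gram ℂ ψ

/-- The positive square root of the Gram matrix. -/
noncomputable def sqrtG (ψ : BlockIndex r → H) : BlockMatrix r := CFC.sqrt (G ψ)

/-- The vectors `u b = ∑ a, (G⁻¹) a b • ψ a`, biorthogonal to the `ψ a`. -/
noncomputable def dualVec (ψ : BlockIndex r → H) (b : BlockIndex r) : H :=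
  ∑ a, (G ψ)⁻¹ a b • ψ a

/-- The `i`-th diagonal block `X^(ii)` of `G^{1/2} W`. -/
noncomputable def X (ψ : BlockIndex r → H) (W : BlockMatrix r) (i : Fin m) :
    Matrix (Fin (r i)) (Fin (r i)) ℂ :=
  Matrix.blockDiag' (sqrtG ψ * W) i

/-- The block diagonal matrix `D` formed by the diagonal blocks of `G^{1/2} W`. -/
noncomputable def D (ψ : BlockIndex r → H) (W : BlockMatrix r) : BlockMatrix r :=
  Matrix.blockDiagonal' (X ψ W)

/-- `W` is the unitary matrix that expands the vectors `w` in the vectors `u`, i.e.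
`w b = ∑ a, (G^{1/2} W) a b • u a`, and the diagonal blocks of `G^{1/2} W` are positive
semidefinite. -/
structure IsAdaptedUnitary (ψ w : BlockIndex r → H) (W : BlockMatrix r) : Prop where
  unitary : W ∈ Matrix.unitaryGroup (BlockIndex r) ℂ
  expand : ∀ b, w b = ∑ a, (sqrtG ψ * W) a b • dualVec ψ a
  block_posSemidef : ∀ i, (X ψ W i).PosSemidef

end Vectors

end MED

namespace MED

open scoped InnerProductSpace

/-! ### Positive operators and the optimality conditions for a POVM. -/

section Operators

variable {H : Type*} [NormedAddCommGroup H] [InnerProductSpace ℂ H] {m : ℕ}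

/-! Write `A i = p i • ρ i` and `Z = ∑ i, A i * E i`. Optimality yields `A j ≤ Z` as quadratic forms
(`inner_le_of_isMax`) and `Z * E j = A j * E j` (`sum_mul_mul_eq_of_isMax`). If `Z x = 0`, the first
forces `A i x = 0` for all `i`, so `x` is orthogonal to the spanning family `ψ` and vanishes: `Z` is
injective (`exists_lagrange`).

The second relation shows that `Z` embeds the range of `E i` into that of `ρ i`, so `E i` has rank
at most `r i`. It is then a sum of `r i` operators `|w⟩⟨w|`, and the resulting `dim H` vectors form
a Parseval frame, hence an orthonormal basis. By biorthogonality, `G^{1/2} W` is the overlap matrix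
`⟪ψ a, w b⟫`. A kernel vector of its `i`-th diagonal block is a vector `v = E i v` with `A i v = 0`,
whence `Z v = A i v = 0` and `v = 0`. So every block is invertible (`isUnit_blockDiag'_overlap`).
For existence, a polar decomposition of each block rotates `w` until the blocks are positive. -/

lemma ketbra_apply (v x : H) : ketbra v x = ⟪v, x⟫_ℂ • v := rfl

lemma ketbra_smul (c : ℂ) (v : H) : ketbra (c • v) = (c * star c) • ketbra v := by
  ext x
  simp only [ketbra_apply, LinearMap.smul_apply, inner_smul_left, smul_smul]
  congr 1
  simp only [RCLike.star_def]
  ring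

lemma ketbra_isPositive (v : H) : (ketbra v).IsPositive := by
  refine ⟨fun x y => ?_, fun x => ?_⟩
  · simp only [ketbra_apply, inner_smul_left, inner_smul_right, inner_conj_symm]
    ring
  · simp only [ketbra_apply, inner_smul_left]
    rw [mul_comm, ← inner_conj_symm, ← inner_conj_symm x v, RCLike.conj_conj, inner_conj_symm,
      inner_mul_symm_re_eq_norm]
    positivity

lemma sum_ketbra_apply {ι : Type*} [Fintype ι] (v : ι → H) (x : H) :
    (∑ j, ketbra (v j)) x = ∑ j, ⟪v j, x⟫_ℂ • v j := by
  simp [LinearMap.sum_apply, ketbra_apply]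

lemma inner_apply_nonneg {B : H →ₗ[ℂ] H} (hB : B.IsPositive) (x : H) :
    0 ≤ (⟪x, B x⟫_ℂ).re := hB.re_inner_nonneg_right x

lemma ketbra_mul_self {x : H} (hx : ‖x‖ = 1) : ketbra x * ketbra x = ketbra x := by
  ext y
  simp [ketbra_apply, hx]

variable [FiniteDimensional ℂ H]

lemma trace_mul_ketbra (A : H →ₗ[ℂ] H) (v : H) :
    LinearMap.trace ℂ H (A * ketbra v) = ⟪v, A v⟫_ℂ := by
  rw [← InnerProductSpace.trace_rankOne (A v) v]
  congr 1
  ext x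
  simp [ketbra_apply]

/-- A positive operator of rank at most `k` is a sum of `k` rank-one operators `|v⟩⟨v|`. -/
lemma exists_eq_sum_ketbra {E : H →ₗ[ℂ] H} (hE : E.IsPositive) {k : ℕ}
    (hk : Module.finrank ℂ (LinearMap.range E) ≤ k) :
    ∃ v : Fin k → H, E = ∑ j, ketbra (v j) := by
  classical
  set b := hE.isSymmetric.eigenvectorBasis rfl with hb
  set μ := hE.isSymmetric.eigenvalues rfl with hμ
  have hbμ : ∀ i, E (b i) = (μ i : ℂ) • b i := fun i =>
    hE.isSymmetric.apply_eigenvectorBasis rfl i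
  have hμ0 : ∀ i, 0 ≤ μ i := fun i => hE.nonneg_eigenvalues rfl i
  have hsum : E = ∑ i, (μ i : ℂ) • ketbra (b i) := by
    ext x
    conv_lhs => rw [← b.sum_repr' x]
    simp only [map_sum, map_smul, hbμ, LinearMap.sum_apply, LinearMap.smul_apply, ketbra_apply,
      smul_smul, mul_comm]
  have hcard : Fintype.card {i // μ i ≠ 0} ≤ k := by
    refine le_trans ?_ hk
    have hli : LinearIndependent ℂ fun i : {i // μ i ≠ 0} => b i :=
      b.toBasis.linearIndependent.comp _ Subtype.val_injective |> fun h => by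
        simpa [Function.comp_def] using h
    rw [← finrank_span_eq_card hli]
    refine Submodule.finrank_mono (Submodule.span_le.2 ?_)
    rintro _ ⟨i, rfl⟩
    refine ⟨(μ i : ℂ)⁻¹ • b i, ?_⟩
    have : (μ i : ℂ) ≠ 0 := by exact_mod_cast i.2
    rw [map_smul, hbμ, smul_smul, inv_mul_cancel₀ this, one_smul]
  obtain ⟨f⟩ : Nonempty ({i // μ i ≠ 0} ↪ Fin k) :=
    Function.Embedding.nonempty_of_card_le (by simpa using hcard)
  let u : {i // μ i ≠ 0} → H := fun i => ((√(μ i) : ℝ) : ℂ) • b i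
  -- Scaled eigenvectors with nonzero eigenvalue, padded with zero vectors up to `k`.
  refine ⟨Function.extend f u 0, ?_⟩
  rw [← Fintype.sum_of_injective f f.injective (fun i => ketbra (u i)) _ ?_ ?_]
  · have hu : ∀ i, ketbra (u i) = (μ i : ℂ) • ketbra (b i) := fun i => by
      rw [ketbra_smul, RCLike.star_def, Complex.conj_ofReal, ← Complex.ofReal_mul,
        Real.mul_self_sqrt (hμ0 _)]
    rw [hsum, Finset.sum_congr rfl fun i _ => hu i,
      ← Finset.sum_subtype (Finset.univ.filter fun i => μ i ≠ 0) (by simp)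
        (fun i => (μ i : ℂ) • ketbra (b i)), Finset.sum_filter]
    refine Finset.sum_congr rfl fun i _ => ?_
    split_ifs with h
    · rfl
    · simp [not_not.1 h]
  · intro j hj
    rw [Function.extend_apply' _ _ _ (by simpa using hj)]
    ext x; simp [ketbra_apply]
  · intro i
    rw [f.injective.extend_apply]

/-- A vector on which the quadratic form of a positive operator vanishes is in the kernel. -/
lemma apply_eq_zero_of_inner_le {B : H →ₗ[ℂ] H} (hB : B.IsPositive) {x : H}
    (hx : (⟪x, B x⟫_ℂ).re ≤ 0) : B x = 0 := by
  obtain ⟨v, hv⟩ := exists_eq_sum_ketbra hB le_rfl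
  have h : (⟪x, B x⟫_ℂ).re = ∑ j, ‖⟪v j, x⟫_ℂ‖ ^ 2 := by
    conv_lhs => rw [hv, sum_ketbra_apply, inner_sum, Complex.re_sum]
    refine Finset.sum_congr rfl fun j _ => ?_
    rw [inner_smul_right, ← inner_conj_symm x (v j), RCLike.mul_conj]
    norm_cast
  rw [h] at hx
  have h0 := (Finset.sum_eq_zero_iff_of_nonneg (fun j _ => by positivity)).1
    (le_antisymm hx (Finset.sum_nonneg fun j _ => by positivity))
  rw [hv, sum_ketbra_apply]
  refine Finset.sum_eq_zero fun j hj => ?_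
  have := h0 j hj
  rw [pow_eq_zero_iff two_ne_zero, norm_eq_zero] at this
  rw [this, zero_smul]

lemma re_trace_mul_nonneg {B E : H →ₗ[ℂ] H} (hB : B.IsPositive) (hE : E.IsPositive) :
    0 ≤ (LinearMap.trace ℂ H (B * E)).re := by
  obtain ⟨v, hv⟩ := exists_eq_sum_ketbra hE le_rfl
  rw [hv, Finset.mul_sum, map_sum, Complex.re_sum]
  exact Finset.sum_nonneg fun j _ => by
    rw [trace_mul_ketbra]; exact inner_apply_nonneg hB _

lemma mul_eq_zero_of_trace {B E : H →ₗ[ℂ] H} (hB : B.IsPositive) (hE : E.IsPositive)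
    (h : (LinearMap.trace ℂ H (B * E)).re = 0) : B * E = 0 := by
  obtain ⟨v, hv⟩ := exists_eq_sum_ketbra hE le_rfl
  rw [hv, Finset.mul_sum, map_sum, Complex.re_sum] at h
  simp only [trace_mul_ketbra] at h
  have h0 := (Finset.sum_eq_zero_iff_of_nonneg
    (fun j _ => inner_apply_nonneg hB (v j))).1 h
  rw [hv]
  ext x
  rw [Module.End.mul_apply, sum_ketbra_apply, map_sum, LinearMap.zero_apply]
  exact Finset.sum_eq_zero fun j hj => by
    rw [map_smul, apply_eq_zero_of_inner_le hB (h0 j hj).le, smul_zero]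

/-- The success functional along the perturbation `(1 - t P) E (1 - t P)`, `P = |x⟩⟨x|`. -/
lemma re_trace_perturb {A E : H →ₗ[ℂ] H} (hA : A.IsPositive) (hE : E.IsPositive) (x : H) (t : ℝ) :
    (LinearMap.trace ℂ H (A * ((1 - (t : ℂ) • ketbra x) * E * (1 - (t : ℂ) • ketbra x)))).re =
      (LinearMap.trace ℂ H (A * E)).re - 2 * t * (⟪x, (A * E) x⟫_ℂ).re
        + t ^ 2 * (LinearMap.trace ℂ H (A * (ketbra x * E * ketbra x))).re := by
  have h1 : A * ((1 - (t : ℂ) • ketbra x) * E * (1 - (t : ℂ) • ketbra x)) =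
      A * E - (t : ℂ) • (A * E * ketbra x) - (t : ℂ) • (A * ketbra x * E)
        + ((t ^ 2 : ℝ) : ℂ) • (A * (ketbra x * E * ketbra x)) := by
    simp only [sub_mul, mul_sub, one_mul, mul_one, smul_mul_assoc, mul_smul_comm, mul_assoc]
    push_cast
    module
  have h2 : LinearMap.trace ℂ H (A * ketbra x * E) = star ⟪x, (A * E) x⟫_ℂ := by
    rw [LinearMap.trace_mul_comm, ← mul_assoc, trace_mul_ketbra, RCLike.star_def,
      inner_conj_symm, Module.End.mul_apply, Module.End.mul_apply, hA.isSymmetric,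
      hE.isSymmetric]
  rw [h1, map_add, map_sub, map_sub, map_smul, map_smul, map_smul, h2, trace_mul_ketbra]
  simp only [smul_eq_mul, Complex.add_re, Complex.sub_re, Complex.re_ofReal_mul, RCLike.star_def,
    Complex.conj_re]
  ring

lemma isPositive_perturb {E : H →ₗ[ℂ] H} (hE : E.IsPositive) (x : H) (t : ℝ) :
    ((1 - (t : ℂ) • ketbra x) * E * (1 - (t : ℂ) • ketbra x)).IsPositive := by
  have hK : LinearMap.adjoint (1 - (t : ℂ) • ketbra x) = 1 - (t : ℂ) • ketbra x := by
    rw [map_sub, LinearEquiv.map_smulₛₗ, (ketbra_isPositive x).adjoint_eq,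
      LinearMap.isPositive_one.adjoint_eq, Complex.conj_ofReal]
  have := hE.conj_adjoint (1 - (t : ℂ) • ketbra x)
  rwa [hK] at this

/-- Perturbing one element of a POVM in the direction of a unit vector gives a POVM. -/
lemma isPOVM_perturb {E : Fin m → (H →ₗ[ℂ] H)} (hE : IsPOVM E) {x : H} (hx : ‖x‖ = 1)
    {t : ℝ} (h0 : 0 ≤ t) (h2 : t ≤ 2) (j : Fin m) :
    IsPOVM fun i => (1 - (t : ℂ) • ketbra x) * E i * (1 - (t : ℂ) • ketbra x) +
      if i = j then ((t * (2 - t) : ℝ) : ℂ) • ketbra x else 0 := by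
  refine ⟨fun i => (isPositive_perturb (hE.pos i) x t).add ?_, ?_⟩
  · split_ifs
    · refine (ketbra_isPositive x).smul_of_nonneg ?_
      exact_mod_cast mul_nonneg h0 (by linarith)
    · exact LinearMap.isPositive_zero
  -- As `P` is a projection, `(1 - t P)² = 1 - t (2 - t) P`; the term given to `j` restores the
  -- deficit.
  · rw [Finset.sum_add_distrib, ← Finset.sum_mul, ← Finset.mul_sum, hE.sum_eq_one]
    simp only [sub_mul, mul_sub, one_mul, mul_one, smul_mul_assoc, mul_smul_comm,
      ketbra_mul_self hx, Finset.sum_ite_eq', Finset.mem_univ, if_true]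
    push_cast
    module

variable {A E : Fin m → (H →ₗ[ℂ] H)}

/-- Holevo's inequality `A j ≤ ∑ i, A i E i` for a maximizer `E` of `∑ i, Tr (A i E i)`. -/
lemma inner_le_of_isMax (hA : ∀ i, (A i).IsPositive) (hE : IsPOVM E)
    (hmax : ∀ F : Fin m → (H →ₗ[ℂ] H), IsPOVM F →
      ∑ i, (LinearMap.trace ℂ H (A i * F i)).re ≤ ∑ i, (LinearMap.trace ℂ H (A i * E i)).re)
    (j : Fin m) (x : H) : (⟪x, A j x⟫_ℂ).re ≤ (⟪x, (∑ i, A i * E i) x⟫_ℂ).re := by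
  suffices key : ∀ x : H, ‖x‖ = 1 →
      (⟪x, A j x⟫_ℂ).re ≤ (⟪x, (∑ i, A i * E i) x⟫_ℂ).re by
    rcases eq_or_ne x 0 with rfl | hx
    · simp
    have hn : 0 < ‖x‖ := norm_pos_iff.2 hx
    have hxy : x = (‖x‖ : ℂ) • ((‖x‖⁻¹ : ℝ) : ℂ) • x := by
      rw [smul_smul, ← Complex.ofReal_mul, mul_inv_cancel₀ hn.ne']; simp
    have h1 := key (((‖x‖⁻¹ : ℝ) : ℂ) • x) (by
      rw [norm_smul, Complex.norm_real, norm_inv, norm_norm, inv_mul_cancel₀ hn.ne'])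
    generalize ((‖x‖⁻¹ : ℝ) : ℂ) • x = y at hxy h1
    rw [hxy]
    simp only [map_smul, inner_smul_left, inner_smul_right, Complex.conj_ofReal,
      Complex.re_ofReal_mul]
    gcongr
  intro x hx
  set a := (⟪x, A j x⟫_ℂ).re with ha
  set z := (⟪x, (∑ i, A i * E i) x⟫_ℂ).re with hz
  set c := ∑ i, (LinearMap.trace ℂ H (A i * (ketbra x * E i * ketbra x))).re with hc
  have hz' : z = ∑ i, (⟪x, (A i * E i) x⟫_ℂ).re := by
    rw [hz, LinearMap.sum_apply, inner_sum, Complex.re_sum]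
  -- The gain in the objective along the perturbation; its first-order coefficient `2 (a - z)` must
  -- not be positive.
  have hineq : ∀ t : ℝ, 0 ≤ t → t ≤ 2 → t * (2 * (a - z) + t * (c - a)) ≤ 0 := by
    intro t h0 h2
    have h := hmax _ (isPOVM_perturb hE hx h0 h2 j)
    simp only [mul_add, map_add, Complex.add_re, Finset.sum_add_distrib,
      re_trace_perturb (hA _) (hE.pos _), Finset.sum_sub_distrib, ← Finset.mul_sum] at h
    rw [← hz', ← hc] at h
    have h3 : ∑ i, (LinearMap.trace ℂ H (A i *
        if i = j then ((t * (2 - t) : ℝ) : ℂ) • ketbra x else 0)).re = t * (2 - t) * a := by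
      rw [Finset.sum_eq_single j]
      · rw [if_pos rfl, mul_smul_comm, map_smul, trace_mul_ketbra, smul_eq_mul,
          Complex.re_ofReal_mul]
      · intro i _ hi
        simp [hi]
      · simp
    rw [h3] at h
    linarith
  by_contra! hlt
  have hd : 0 < a - z := by linarith
  -- Small enough that the second-order term cannot cancel the first-order gain.
  set t := min 1 ((a - z) / (|c - a| + 1)) with ht
  have habs : 0 < |c - a| + 1 := by positivity
  have ht0 : 0 < t := lt_min one_pos (by positivity)
  have ht1 : t ≤ 1 := min_le_left _ _
  have ht2 : t * (|c - a| + 1) ≤ a - z := by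
    rw [← le_div_iff₀ habs]; exact min_le_right _ _
  have h4 := hineq t ht0.le (by linarith)
  have h5 : 2 * (a - z) + t * (c - a) ≤ 0 := by
    by_contra! h; nlinarith [mul_pos ht0 h]
  nlinarith [neg_abs_le (c - a)]

/-- The complementary slackness condition for a maximizer `E` of `∑ i, Tr (A i E i)`. -/
lemma sum_mul_mul_eq_of_isMax (hA : ∀ i, (A i).IsPositive) (hE : IsPOVM E)
    (hmax : ∀ F : Fin m → (H →ₗ[ℂ] H), IsPOVM F →
      ∑ i, (LinearMap.trace ℂ H (A i * F i)).re ≤ ∑ i, (LinearMap.trace ℂ H (A i * E i)).re)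
    (j : Fin m) : (∑ i, A i * E i) * E j = A j * E j := by
  set Z := ∑ i, A i * E i with hZ
  -- `Z` is not yet known to be self-adjoint, so slackness is first proved for its Hermitian part,
  -- which has the same real quadratic form.
  set Y := (2⁻¹ : ℂ) • (Z + LinearMap.adjoint Z) with hY
  have hYre : ∀ x, (⟪x, Y x⟫_ℂ).re = (⟪x, Z x⟫_ℂ).re := by
    intro x
    have : (⟪x, LinearMap.adjoint Z x⟫_ℂ).re = (⟪x, Z x⟫_ℂ).re := by
      rw [LinearMap.adjoint_inner_right, ← inner_conj_symm, Complex.conj_re]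
    rw [hY, LinearMap.smul_apply, inner_smul_right, LinearMap.add_apply, inner_add_right,
      show (2⁻¹ : ℂ) = ((2⁻¹ : ℝ) : ℂ) by norm_num, Complex.re_ofReal_mul, Complex.add_re, this]
    ring
  have hYsymm : Y.IsSymmetric := by
    rw [LinearMap.isSymmetric_iff_isSelfAdjoint, LinearMap.isSelfAdjoint_iff', hY,
      show (2⁻¹ : ℂ) = ((2⁻¹ : ℝ) : ℂ) by norm_num, LinearEquiv.map_smulₛₗ, map_add,
      LinearMap.adjoint_adjoint, add_comm, Complex.conj_ofReal]
  have hpos : ∀ i, (Y - A i).IsPositive := by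
    intro i
    refine ⟨hYsymm.sub (hA i).isSymmetric, fun x => ?_⟩
    rw [hYsymm.sub (hA i).isSymmetric, LinearMap.sub_apply, inner_sub_right]
    have := inner_le_of_isMax hA hE hmax i x
    have h2 := hYre x
    simp only [map_sub, RCLike.re_to_complex]
    rw [h2]
    exact sub_nonneg.2 this
  have htr : (LinearMap.trace ℂ H Y).re = (LinearMap.trace ℂ H Z).re := by
    simp only [LinearMap.trace_eq_sum_inner _ (stdOrthonormalBasis ℂ H), Complex.re_sum, hYre]
  have hsum : ∑ i, (LinearMap.trace ℂ H ((Y - A i) * E i)).re = 0 := by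
    simp only [sub_mul, map_sub, Complex.sub_re, Finset.sum_sub_distrib]
    rw [← Complex.re_sum, ← map_sum, ← Finset.mul_sum, hE.sum_eq_one, mul_one, htr, hZ, map_sum,
      Complex.re_sum, sub_self]
  have hzero : ∀ i, (Y - A i) * E i = 0 := fun i =>
    mul_eq_zero_of_trace (hpos i) (hE.pos i) <|
      (Finset.sum_eq_zero_iff_of_nonneg
        (fun i _ => re_trace_mul_nonneg (hpos i) (hE.pos i))).1 hsum i (Finset.mem_univ i)
  -- Summing `Y * E i = A i * E i` over `i` and using `∑ i, E i = 1` gives `Y = Z`.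
  have hYZ : Y = Z := by
    have h := Finset.sum_eq_zero (s := Finset.univ) fun i _ => hzero i
    simp only [sub_mul, Finset.sum_sub_distrib] at h
    rw [← Finset.mul_sum, hE.sum_eq_one, mul_one, sub_eq_zero] at h
    exact h
  have := hzero j
  rw [hYZ, sub_mul, sub_eq_zero] at this
  exact this

end Operators

/-! ### Unitary mixing and Parseval frames. -/

section Frames

variable {H : Type*} [NormedAddCommGroup H] [InnerProductSpace ℂ H]

/-- The family `∑ k, V k j • w k` with `V` unitary has the same frame operator as `w`. -/
lemma sum_ketbra_unitary {ι : Type*} [Fintype ι] [DecidableEq ι] {V : Matrix ι ι ℂ}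
    (hV : V * V.conjTranspose = 1) (w : ι → H) :
    ∑ j, ketbra (∑ k, V k j • w k) = ∑ k, ketbra (w k) := by
  ext x
  rw [sum_ketbra_apply, sum_ketbra_apply]
  calc ∑ j, ⟪∑ k, V k j • w k, x⟫_ℂ • ∑ l, V l j • w l
      = ∑ j, ∑ l, ∑ k, (V l j * star (V k j)) • ⟪w k, x⟫_ℂ • w l := by
        refine Finset.sum_congr rfl fun j _ => ?_
        rw [Finset.smul_sum]
        refine Finset.sum_congr rfl fun l _ => ?_
        rw [sum_inner, Finset.sum_smul]
        refine Finset.sum_congr rfl fun k _ => ?_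
        rw [inner_smul_left, smul_smul, smul_smul, RCLike.star_def]
        congr 1
        ring
    _ = ∑ l, ∑ k, (V * V.conjTranspose) l k • ⟪w k, x⟫_ℂ • w l := by
        rw [Finset.sum_comm]
        refine Finset.sum_congr rfl fun l _ => ?_
        rw [Finset.sum_comm]
        refine Finset.sum_congr rfl fun k _ => ?_
        rw [Matrix.mul_apply, Finset.sum_smul]
        rfl
    _ = ∑ k, ⟪w k, x⟫_ℂ • w k := by
        simp [hV, Matrix.one_apply]

variable [FiniteDimensional ℂ H]

omit [FiniteDimensional ℂ H] in
/-- A Parseval frame of `dim H` vectors is an orthonormal basis. -/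
lemma orthonormal_of_sum_ketbra_eq_one {ι : Type*} [Fintype ι] {w : ι → H}
    (h : ∑ b, ketbra (w b) = 1) (hcard : Fintype.card ι = Module.finrank ℂ H) :
    Orthonormal ℂ w := by
  classical
  have hx : ∀ x, ∑ b, ⟪w b, x⟫_ℂ • w b = x := fun x => by
    rw [← sum_ketbra_apply, h, Module.End.one_apply]
  have hli : LinearIndependent ℂ w := by
    refine linearIndependent_of_top_le_span_of_card_eq_finrank (fun x _ => ?_) hcard
    rw [← hx x]
    exact Submodule.sum_mem _ fun b _ => Submodule.smul_mem _ _ (Submodule.subset_span ⟨b, rfl⟩)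
  rw [orthonormal_iff_ite]
  intro a c
  -- The frame expansion of `w c` must agree with its trivial one, by linear independence.
  have h0 : ∑ b, (⟪w b, w c⟫_ℂ - if b = c then 1 else 0) • w b = 0 := by
    simp [sub_smul, hx]
  exact sub_eq_zero.1 (Fintype.linearIndependent_iff.1 hli _ h0 a)

end Frames

/-! ### LI ensembles, the Lagrange operator and the overlap matrix. -/

section Ensembles

variable {H : Type*} [NormedAddCommGroup H] [InnerProductSpace ℂ H] [FiniteDimensional ℂ H]
  {m : ℕ} {r : Fin m → ℕ} {p : Fin m → ℝ} {ρ E : Fin m → (H →ₗ[ℂ] H)} {ψ w : BlockIndex r → H}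

omit [FiniteDimensional ℂ H] in
lemma IsLIEnsemble.card_blockIndex (hens : IsLIEnsemble r p ρ) :
    Fintype.card (BlockIndex r) = Module.finrank ℂ H := by
  simp [BlockIndex, hens.rank_sum]

/-- Independence makes the direct sum of the supports inject into `H`, and the ranks add up to its
dimension. -/
lemma IsLIEnsemble.iSup_range (hens : IsLIEnsemble r p ρ) :
    ⨆ i, LinearMap.range (ρ i) = ⊤ := by
  classical
  rw [Submodule.iSup_eq_range_dfinsupp_lsum]
  apply Submodule.eq_top_of_finrank_eq
  rw [LinearMap.finrank_range_of_inj hens.supp_indep.dfinsupp_lsum_injective, ← hens.rank_sum]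
  exact (Module.finrank_directSum (R := ℂ) fun i => LinearMap.range (ρ i)).trans
    (Finset.sum_congr rfl fun i _ => hens.rank_eq i)

lemma IsLIEnsemble.top_le_span (hens : IsLIEnsemble r p ρ) (hψ : IsPureDecomposition p ρ ψ) :
    ⊤ ≤ Submodule.span ℂ (Set.range ψ) := by
  rw [← hens.iSup_range]
  refine iSup_le fun i => ?_
  rintro _ ⟨x, rfl⟩
  have hp : (p i : ℂ) ≠ 0 := by exact_mod_cast (hens.prob_pos i).ne'
  have : ρ i x = (p i : ℂ)⁻¹ • ∑ j, ⟪ψ ⟨i, j⟩, x⟫_ℂ • ψ ⟨i, j⟩ := by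
    rw [← sum_ketbra_apply, ← hψ i, LinearMap.smul_apply, smul_smul, inv_mul_cancel₀ hp, one_smul]
  rw [this]
  exact Submodule.smul_mem _ _ <| Submodule.sum_mem _ fun j _ =>
    Submodule.smul_mem _ _ (Submodule.subset_span ⟨_, rfl⟩)

lemma IsLIEnsemble.linearIndependent (hens : IsLIEnsemble r p ρ)
    (hψ : IsPureDecomposition p ρ ψ) : LinearIndependent ℂ ψ :=
  linearIndependent_of_top_le_span_of_card_eq_finrank (hens.top_le_span hψ) hens.card_blockIndex

omit [FiniteDimensional ℂ H] in
lemma eq_zero_of_forall_inner_eq_zero {ι : Type*} {ψ : ι → H}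
    (hspan : ⊤ ≤ Submodule.span ℂ (Set.range ψ)) {x : H} (hx : ∀ a, ⟪ψ a, x⟫_ℂ = 0) : x = 0 := by
  have : Submodule.span ℂ (Set.range ψ) ≤ (ℂ ∙ x)ᗮ := by
    rw [Submodule.span_le]
    rintro _ ⟨a, rfl⟩
    exact Submodule.mem_orthogonal_singleton_iff_inner_left.2 (hx a)
  exact inner_self_eq_zero.1
    (Submodule.mem_orthogonal_singleton_iff_inner_left.1 (this (hspan Submodule.mem_top)))

/-- For an optimal POVM `E` on an LI ensemble there is an injective operator `Z` (the Lagrange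
operator) with `Z * E i = p i • ρ i * E i`. -/
lemma exists_lagrange (hens : IsLIEnsemble r p ρ) (hopt : IsOptimalPOVM p ρ E)
    (hψ : IsPureDecomposition p ρ ψ) :
    ∃ Z : H →ₗ[ℂ] H, (∀ x, Z x = 0 → x = 0) ∧ ∀ i, Z * E i = ((p i : ℂ) • ρ i) * E i := by
  set A : Fin m → (H →ₗ[ℂ] H) := fun i => (p i : ℂ) • ρ i with hAdef
  have hA : ∀ i, (A i).IsPositive := fun i =>
    (hens.state_pos i).smul_of_nonneg (by exact_mod_cast (hens.prob_pos i).le)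
  have hs : ∀ F : Fin m → (H →ₗ[ℂ] H),
      ∑ i, (LinearMap.trace ℂ H (A i * F i)).re = successProb p ρ F := fun F => by
    simp only [successProb, hAdef, smul_mul_assoc, map_smul, smul_eq_mul, Complex.re_ofReal_mul]
  have hmax : ∀ F : Fin m → (H →ₗ[ℂ] H), IsPOVM F →
      ∑ i, (LinearMap.trace ℂ H (A i * F i)).re ≤ ∑ i, (LinearMap.trace ℂ H (A i * E i)).re :=
    fun F hF => by rw [hs, hs]; exact hopt.2 F hF
  refine ⟨∑ i, A i * E i, fun x hx => ?_, sum_mul_mul_eq_of_isMax hA hopt.1 hmax⟩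
  refine eq_zero_of_forall_inner_eq_zero (hens.top_le_span hψ) ?_
  rintro ⟨i, k⟩
  have h0 : A i x = 0 := apply_eq_zero_of_inner_le (hA i) <| by
    simpa [hx] using inner_le_of_isMax hA hopt.1 hmax i x
  have hli : LinearIndependent ℂ fun j : Fin (r i) => ψ ⟨i, j⟩ :=
    (hens.linearIndependent hψ).comp _ sigma_mk_injective
  rw [hAdef] at h0
  simp only [hψ i, sum_ketbra_apply] at h0
  exact Fintype.linearIndependent_iff.1 hli _ h0 k

omit [FiniteDimensional ℂ H] in
lemma IsPOVM.sum_ketbra_eq_one (hE : IsPOVM E)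
    (hw : ∀ i, E i = ∑ j : Fin (r i), ketbra (w ⟨i, j⟩)) : ∑ b, ketbra (w b) = 1 := by
  rw [Fintype.sum_sigma, ← hE.sum_eq_one]
  exact Finset.sum_congr rfl fun i _ => (hw i).symm

omit [FiniteDimensional ℂ H] in
lemma isSpectralDecomposition_of_eq_sum (hens : IsLIEnsemble r p ρ) (hE : IsPOVM E)
    (hw : ∀ i, E i = ∑ j : Fin (r i), ketbra (w ⟨i, j⟩)) : IsSpectralDecomposition E w :=
  ⟨orthonormal_of_sum_ketbra_eq_one (hE.sum_ketbra_eq_one hw) hens.card_blockIndex, hw⟩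

/-- The optimal POVM of an LI ensemble is projective with the ranks of the states. -/
lemma exists_isSpectralDecomposition (hens : IsLIEnsemble r p ρ) (hopt : IsOptimalPOVM p ρ E)
    (hψ : IsPureDecomposition p ρ ψ) : ∃ w : BlockIndex r → H, IsSpectralDecomposition E w := by
  obtain ⟨Z, hZ, hZE⟩ := exists_lagrange hens hopt hψ
  have hrank : ∀ i, Module.finrank ℂ (LinearMap.range (E i)) ≤ r i := by
    intro i
    have hinj : Function.Injective Z := (injective_iff_map_eq_zero Z).2 hZ
    rw [← hens.rank_eq i, (Submodule.equivMapOfInjective Z hinj _).finrank_eq]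
    refine Submodule.finrank_mono ?_
    rintro _ ⟨_, ⟨x, rfl⟩, rfl⟩
    refine ⟨(p i : ℂ) • E i x, ?_⟩
    have := LinearMap.congr_fun (hZE i) x
    simp only [Module.End.mul_apply, LinearMap.smul_apply] at this
    rw [map_smul, this]
  choose v hv using fun i => exists_eq_sum_ketbra (hopt.1.pos i) (hrank i)
  exact ⟨fun a => v a.1 a.2, isSpectralDecomposition_of_eq_sum hens hopt.1 hv⟩

/-- The matrix of the overlaps `⟪ψ a, w b⟫`. -/
noncomputable def overlap (ψ w : BlockIndex r → H) : BlockMatrix r :=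
  Matrix.of fun a b => ⟪ψ a, w b⟫_ℂ

/-- The diagonal blocks of the overlap matrix of `ψ` and a spectral decomposition of the optimal
POVM are invertible. -/
lemma isUnit_blockDiag'_overlap (hens : IsLIEnsemble r p ρ) (hopt : IsOptimalPOVM p ρ E)
    (hψ : IsPureDecomposition p ρ ψ) (hw : IsSpectralDecomposition E w) (i : Fin m) :
    IsUnit (Matrix.blockDiag' (overlap ψ w) i) := by
  obtain ⟨Z, hZ, hZE⟩ := exists_lagrange hens hopt hψ
  rw [← Matrix.mulVec_injective_iff_isUnit]
  rw [← Matrix.coe_mulVecLin, injective_iff_map_eq_zero]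
  intro c hc
  have hon : Orthonormal ℂ fun j : Fin (r i) => w ⟨i, j⟩ := hw.1.comp _ sigma_mk_injective
  set v := ∑ j, c j • w ⟨i, j⟩ with hv
  have hEv : E i v = v := by
    rw [hw.2 i, sum_ketbra_apply]
    conv_rhs => rw [hv]
    refine Finset.sum_congr rfl fun j _ => ?_
    rw [hv, hon.inner_right_fintype]
  have hψv : ∀ k, ⟪ψ ⟨i, k⟩, v⟫_ℂ = 0 := fun k => by
    have := congrFun hc k
    simp only [Matrix.mulVecLin_apply, Matrix.mulVec, dotProduct, Matrix.blockDiag'_apply,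
      overlap, Matrix.of_apply, Pi.zero_apply] at this
    rw [hv, inner_sum, ← this]
    exact Finset.sum_congr rfl fun j _ => by rw [inner_smul_right, mul_comm]
  have hZv : Z v = 0 := by
    have := LinearMap.congr_fun (hZE i) v
    rw [Module.End.mul_apply, Module.End.mul_apply, hEv, hψ i, sum_ketbra_apply] at this
    rw [this]
    exact Finset.sum_eq_zero fun k _ => by rw [hψv k, zero_smul]
  funext j
  exact Fintype.linearIndependent_iff.1 hon.linearIndependent c (hZ v hZv) j

-- Parseval's identity; it is what makes `(G^{1/2})⁻¹ * overlap ψ w` unitary.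
omit [FiniteDimensional ℂ H] in
lemma gram_eq_overlap_mul (h : ∑ b, ketbra (w b) = 1) :
    G ψ = overlap ψ w * (overlap ψ w).conjTranspose := by
  ext a c
  rw [G, Matrix.gram_apply, ← Module.End.one_apply (R := ℂ) (ψ c), ← h, sum_ketbra_apply,
    inner_sum, Matrix.mul_apply]
  refine Finset.sum_congr rfl fun b _ => ?_
  rw [inner_smul_right, Matrix.conjTranspose_apply, overlap, Matrix.of_apply, Matrix.of_apply,
    RCLike.star_def, inner_conj_symm, mul_comm]

omit [FiniteDimensional ℂ H] in
lemma inner_sum_dualVec (hli : LinearIndependent ℂ ψ) (M : BlockMatrix r) (a b : BlockIndex r) :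
    ⟪ψ a, ∑ c, M c b • dualVec ψ c⟫_ℂ = M a b := by
  have hG : IsUnit (G ψ).det :=
    (Matrix.isUnit_iff_isUnit_det _).1 (Matrix.posDef_gram_of_linearIndependent hli).isUnit
  have h : ∀ c, ⟪ψ a, dualVec ψ c⟫_ℂ = (1 : BlockMatrix r) a c := fun c => by
    rw [← Matrix.mul_nonsing_inv _ hG, Matrix.mul_apply, dualVec, inner_sum]
    exact Finset.sum_congr rfl fun d _ => by rw [inner_smul_right, mul_comm]; rfl
  simp only [inner_sum, inner_smul_right, h, Matrix.one_apply, mul_ite, mul_one, mul_zero,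
    Finset.sum_ite_eq, Finset.mem_univ, if_true]

omit [FiniteDimensional ℂ H] in
/-- The expansion of `w` in the dual vectors is given by the overlaps with `ψ`. -/
lemma expand_iff (hli : LinearIndependent ℂ ψ) (hspan : ⊤ ≤ Submodule.span ℂ (Set.range ψ))
    (M : BlockMatrix r) : (∀ b, w b = ∑ a, M a b • dualVec ψ a) ↔ overlap ψ w = M := by
  constructor
  · intro h
    ext a b
    rw [overlap, Matrix.of_apply, h b, inner_sum_dualVec hli]
  · rintro rfl b
    rw [← sub_eq_zero]
    refine eq_zero_of_forall_inner_eq_zero hspan fun a => ?_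
    rw [inner_sub_right, inner_sum_dualVec hli, overlap, Matrix.of_apply, sub_self]

end Ensembles

/-! ### Polar decomposition and block diagonal matrices. -/

section Matrices

open Matrix

/-- Polar decomposition of an invertible matrix: `M * V` is positive
semidefinite for some unitary `V`. -/
lemma exists_unitary_mul_posSemidef {n : Type*} [Fintype n] [DecidableEq n] {M : Matrix n n ℂ}
    (hM : IsUnit M) : ∃ V : Matrix n n ℂ, V * Vᴴ = 1 ∧ (M * V).PosSemidef := by
  have hdet := (Matrix.isUnit_iff_isUnit_det _).1 hM
  have hP : (M * Mᴴ).PosSemidef := posSemidef_self_mul_conjTranspose M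
  have hS : (CFC.sqrt (M * Mᴴ)).PosSemidef := (CFC.sqrt_nonneg (M * Mᴴ)).posSemidef
  -- Chosen so that `M * V` is the positive factor `(M Mᴴ)^{1/2}`.
  refine ⟨M⁻¹ * CFC.sqrt (M * Mᴴ), ?_, ?_⟩
  · rw [conjTranspose_mul, hS.isHermitian.eq, Matrix.mul_assoc,
      ← Matrix.mul_assoc (CFC.sqrt _), CFC.sqrt_mul_sqrt_self _ hP.nonneg, Matrix.mul_assoc,
      ← conjTranspose_mul, nonsing_inv_mul _ hdet, conjTranspose_one, Matrix.mul_one,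
      nonsing_inv_mul _ hdet]
  · rwa [← Matrix.mul_assoc, mul_nonsing_inv _ hdet, Matrix.one_mul]

lemma posSemidef_blockDiagonal' {o : Type*} [Fintype o] [DecidableEq o] {n : o → Type*}
    [∀ i, Fintype (n i)] [∀ i, DecidableEq (n i)] {M : ∀ i, Matrix (n i) (n i) ℂ}
    (hM : ∀ i, (M i).PosSemidef) : (blockDiagonal' M).PosSemidef := by
  choose S hS using fun i => CStarAlgebra.nonneg_iff_eq_star_mul_self.mp (hM i).nonneg
  have : blockDiagonal' M = (blockDiagonal' S)ᴴ * blockDiagonal' S := by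
    rw [blockDiagonal'_conjTranspose, ← blockDiagonal'_mul]
    congr 1
    funext i
    exact hS i
  rw [this]
  exact posSemidef_conjTranspose_mul_self _

lemma isUnit_blockDiagonal' {o : Type*} [Fintype o] [DecidableEq o] {n : o → Type*}
    [∀ i, Fintype (n i)] [∀ i, DecidableEq (n i)] {M : ∀ i, Matrix (n i) (n i) ℂ}
    (hM : ∀ i, IsUnit (M i)) : IsUnit (blockDiagonal' M) :=
  (Pi.isUnit_iff.2 hM).map (blockDiagonal'RingHom n ℂ)

end Matrices

end MED

theorem mainTheorem7 {H : Type*} [NormedAddCommGroup H] [InnerProductSpace ℂ H]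
    [FiniteDimensional ℂ H] {m : ℕ} (r : Fin m → ℕ) (p : Fin m → ℝ)
    (ρ : Fin m → (H →ₗ[ℂ] H)) (hens : MED.IsLIEnsemble r p ρ)
    (E : Fin m → (H →ₗ[ℂ] H)) (hopt : MED.IsOptimalPOVM p ρ E)
    (ψ : MED.BlockIndex r → H) (hψ : MED.IsPureDecomposition p ρ ψ) :
    (∃ (w : MED.BlockIndex r → H) (W : MED.BlockMatrix r),
      MED.IsSpectralDecomposition E w ∧ MED.IsAdaptedUnitary ψ w W) ∧
    ∀ (w : MED.BlockIndex r → H) (W : MED.BlockMatrix r),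
      MED.IsSpectralDecomposition E w → MED.IsAdaptedUnitary ψ w W →
        (∀ i, (MED.X ψ W i).rank = r i) ∧
        (MED.D ψ W).PosDef ∧
        (MED.D ψ W * MED.sqrtG ψ * W).det ≠ 0 := by
  open MED in
  have hli := hens.linearIndependent hψ
  have hspan := hens.top_le_span hψ
  have hG : (G ψ).PosDef := Matrix.posDef_gram_of_linearIndependent hli
  have hSS : sqrtG ψ * sqrtG ψ = G ψ := CFC.sqrt_mul_sqrt_self _ hG.posSemidef.nonneg
  have hSpos : (sqrtG ψ).PosSemidef := 
    Matrix.nonneg_iff_posSemidef.1 (CFC.sqrt_nonneg (G ψ))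
  have hSdet : IsUnit (sqrtG ψ).det := by
    refine isUnit_of_mul_isUnit_left (y := (sqrtG ψ).det) ?_
    rw [← Matrix.det_mul, hSS]
    exact (Matrix.isUnit_iff_isUnit_det _).1 hG.isUnit
  constructor
  · obtain ⟨w₀, hw₀⟩ := exists_isSpectralDecomposition hens hopt hψ
    choose V hV hVpos using fun i =>
      exists_unitary_mul_posSemidef (isUnit_blockDiag'_overlap hens hopt hψ hw₀ i)
    -- Rotating inside block `i` keeps `E i` and multiplies the diagonal overlap block by `V i` on
    -- the right.
    let w : BlockIndex r → H := fun b => ∑ k, V b.1 k b.2 • w₀ ⟨b.1, k⟩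
    have hw : IsSpectralDecomposition E w :=
      isSpectralDecomposition_of_eq_sum hens hopt.1 fun i => by
        rw [hw₀.2 i]
        exact (sum_ketbra_unitary (hV i) fun k => w₀ ⟨i, k⟩).symm
    have hSW : sqrtG ψ * ((sqrtG ψ)⁻¹ * overlap ψ w) = overlap ψ w := by
      rw [← Matrix.mul_assoc, Matrix.mul_nonsing_inv _ hSdet, Matrix.one_mul]
    refine ⟨w, (sqrtG ψ)⁻¹ * overlap ψ w, hw, ?_, ?_, ?_⟩
    · rw [Matrix.mem_unitaryGroup_iff, Matrix.star_eq_conjTranspose, Matrix.conjTranspose_mul,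
        Matrix.conjTranspose_nonsing_inv, hSpos.isHermitian.eq, Matrix.mul_assoc,
        ← Matrix.mul_assoc (overlap ψ w),
        ← gram_eq_overlap_mul (hopt.1.sum_ketbra_eq_one hw.2), ← hSS,
        Matrix.mul_assoc, Matrix.mul_nonsing_inv _ hSdet, Matrix.mul_one,
        Matrix.nonsing_inv_mul _ hSdet]
    · rw [hSW]
      exact (expand_iff hli hspan _).2 rfl
    · intro i
      have : X ψ ((sqrtG ψ)⁻¹ * overlap ψ w) i =
          Matrix.blockDiag' (overlap ψ w₀) i * V i := by
        rw [X, hSW]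
        ext k j
        simp only [Matrix.blockDiag'_apply, overlap, Matrix.of_apply, Matrix.mul_apply, w,
          inner_sum, inner_smul_right]
        exact Finset.sum_congr rfl fun l _ => mul_comm _ _
      rw [this]
      exact hVpos i
  · intro w W hw hW
    have hY : overlap ψ w = sqrtG ψ * W := (expand_iff hli hspan _).1 hW.expand
    have hX : ∀ i, IsUnit (X ψ W i) := fun i => by
      rw [X, ← hY]
      exact isUnit_blockDiag'_overlap hens hopt hψ hw i
    have hD : (D ψ W).PosDef :=
      (posSemidef_blockDiagonal' hW.block_posSemidef).posDef_iff_isUnit.2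
        (isUnit_blockDiagonal' hX)
    refine ⟨fun i => ?_, hD, ?_⟩
    · rw [Matrix.rank_of_isUnit _ (hX i), Fintype.card_fin]
    · have hWdet : IsUnit W.det :=
        (Matrix.isUnit_iff_isUnit_det _).1 (Unitary.toUnits ⟨W, hW.unitary⟩).isUnit
      rw [Matrix.det_mul, Matrix.det_mul]
      exact mul_ne_zero (mul_ne_zero hD.det_pos.ne' hSdet.ne_zero) hWdet.ne_zero
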